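/- Setting. Let $n\ge 0$. An $n$-qubit state is a positive semidefinite $2^n\times 2^n$ complex matrix of trace one; a two-outcome measurement is a Hermitian $2^n\times 2^n$ matrix with eigenvalues in $[0,1]$. In round $t=1,2,\ldots$ a learner predicts an $n$-qubit state $\omega_t$ as a function of the earlier rounds, and an adversary (possibly adaptively) reveals a two-outcome measurement $E_t$ and a real number $b_t$; the loss is $\ell_t(\operatorname{Tr}E_t\omega_t)$ with $\ell_t(z)=(z-b_t)^2$. Put $$L_T^*=\min_{\omega}\sum_{t=1}^T \ell_t(\operatorname{Tr}E_t\omega),\qquad \operatorname{Reg}_T=\sum_{t=1}^T\ell_t(\operatorname{Tr}E_t\omega_t)-L_T^*,$$ the minimum being over all $n$-qubit states. Doubling-trick algorithm. Rounds are divided into blocks $\beta=1,2,\ldots$; block $\beta$ has learning rate $\eta_\beta=\min\{\sqrt{n\ln 2/(2^\beta+1)},\,1/2\}$. In the first round of a block the algorithm predicts $2^{-n}I$. After each round it computes $\nabla_t=2(\operatorname{Tr}(E_t\omega_t)-b_t)E_t$; if the total loss inside the current block $\beta$ is at least $2^\beta$, then block $\beta+1$ starts with the next round. Otherwise the next prediction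 is computed by one of two update rules, fixed in advance: (MEG) $\omega_{t+1}=\exp(G)/\operatorname{Tr}\exp(G)$ with $G=\log\omega_t-\eta_\beta\nabla_t$; or (RFTL) $\omega_{t+1}=\arg\min_{\omega}\{\eta_\beta\sum_s\operatorname{Tr}(\nabla_s\omega)+\operatorname{Tr}(\omega\log\omega)\}$ over all $n$-qubit states, where $s$ runs over the rounds of the current block up to $t$. Statement. (1) There is an absolute constant $C>0$ such that for all $n$, all $T\ge 2$, either update rule and every sequence $(E_t,b_t)$ with $L_T^*=0$ (the realizable case), the doubling-trick algorithm satisfies $\operatorname{Reg}_T\le C\,n\log T$. (2) This nearly matches the lower bound $\Omega(n)$: there is an absolute constant $c>0$ such that for all $n$, all $T\ge n$ and every (deterministic) learner there is a sequence $(E_t,b_t)$ with $L_T^*=0$ for which the learner has $\operatorname{Reg}_T\ge c\,n$. -/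

import Mathlib

namespace QLearn

open scoped ComplexOrder

/-- Operators on the `n`-qubit space `(ℂ²)^{⊗ n}`, as complex matrices whose rows and columns are
indexed by the computational basis, i.e. by bit strings of length `n` (so the dimension is
`2 ^ n`). -/
abbrev Op (n : ℕ) : Type := Matrix (Fin n → Fin 2) (Fin n → Fin 2) ℂ

/-- The set of `n`-qubit states: positive semidefinite matrices of trace one. -/
def State (n : ℕ) : Type := {ρ : Op n // ρ.PosSemidef ∧ ρ.trace = 1}

/-- Two-outcome measurements on `n` qubits: Hermitian matrices `E` with eigenvalues in `[0, 1]`,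
that is `0 ≤ E` and `E ≤ 1`. -/
def Measurement (n : ℕ) : Type := {E : Op n // E.PosSemidef ∧ (1 - E).PosSemidef}

/-- Hermitian operators on `n` qubits. -/
def HermOp (n : ℕ) : Type := {A : Op n // A.IsHermitian}

/-- The probability `Tr (E ω)` of the outcome "Yes". -/
noncomputable def yesProb {n : ℕ} (E : Measurement n) (ω : State n) : ℝ :=
  (E.1 * ω.1).trace.re

/-- What the adversary reveals in one round: a measurement `E_t` and a feedback `b_t`. -/
abbrev Round (n : ℕ) : Type := Measurement n × ℝ

/-- The loss `ℓ_t (Tr (E_t ω)) = (Tr (E_t ω) - b_t)²`. -/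
noncomputable def loss {n : ℕ} (r : Round n) (ω : State n) : ℝ := (yesProb r.1 ω - r.2) ^ 2

/-- A (deterministic) learner: it predicts a state from the list of all past rounds, in
chronological order. -/
abbrev Learner (n : ℕ) : Type := List (Round n) → State n

/-- The prediction of the learner `A` in round `t` (rounds are numbered `0, 1, 2, …`), when the
sequence of measurements and feedbacks is `r`. It depends on the rounds before `t` only. -/
def prediction {n : ℕ} (A : Learner n) (r : ℕ → Round n) (t : ℕ) : State n :=
  A ((List.range t).map r)

/-- The total loss of the learner in the first `T` rounds. -/
noncomputable def learnerLoss {n : ℕ} (A : Learner n) (r : ℕ → Round n) (T : ℕ) : ℝ :=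
  ∑ t ∈ Finset.range T, loss (r t) (prediction A r t)

/-- `L*_T`, the total loss of the best state in hindsight. -/
noncomputable def bestLoss {n : ℕ} (r : ℕ → Round n) (T : ℕ) : ℝ :=
  ⨅ ω : State n, ∑ t ∈ Finset.range T, loss (r t) ω

/-- The regret after `T` rounds. -/
noncomputable def regret {n : ℕ} (A : Learner n) (r : ℕ → Round n) (T : ℕ) : ℝ :=
  learnerLoss A r T - bestLoss r T

/-- The maximally mixed state `2⁻ⁿ I`. -/
noncomputable def maxMixed (n : ℕ) : State n :=
  ⟨((2 : ℂ) ^ n)⁻¹ • (1 : Op n), by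
    constructor
    · apply Matrix.PosSemidef.smul Matrix.PosSemidef.one
      have h : ((2 : ℂ) ^ n)⁻¹ = (((2 : ℝ) ^ n)⁻¹ : ℝ) := by push_cast; rfl
      rw [h]
      exact_mod_cast (by positivity : (0 : ℝ) ≤ ((2 : ℝ) ^ n)⁻¹)
    · simp [Matrix.trace_smul, Matrix.trace_one]⟩

noncomputable instance (n : ℕ) : Nonempty (State n) := ⟨maxMixed n⟩

/-- The gradient `∇_t = 2 (Tr (E_t ω_t) - b_t) E_t`. -/
noncomputable def gradient {n : ℕ} (r : Round n) (ω : State n) : HermOp n :=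
  ⟨(2 * (yesProb r.1 ω - r.2)) • r.1.1, r.1.2.1.isHermitian.smul (IsSelfAdjoint.all _)⟩

theorem posDef_exp {n : ℕ} {G : Op n} (hG : G.IsHermitian) : (NormedSpace.exp G).PosDef := by
  have h2 : (((1 / 2 : ℝ)) • G).IsHermitian := hG.smul (IsSelfAdjoint.all _)
  have h : NormedSpace.exp G
      = (NormedSpace.exp ((1 / 2 : ℝ) • G)).conjTranspose * NormedSpace.exp ((1 / 2 : ℝ) • G) := by
    rw [h2.exp.eq, ← Matrix.exp_add_of_commute _ _ (Commute.refl _), ← add_smul]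
    norm_num
  rw [h]
  exact Matrix.PosDef.conjTranspose_mul_self _
    (Matrix.mulVec_injective_of_isUnit (Matrix.isUnit_exp _))

/-- The state `exp G / Tr (exp G)`, for a Hermitian matrix `G`. -/
noncomputable def gibbs {n : ℕ} (G : HermOp n) : State n :=
  ⟨(NormedSpace.exp G.1).trace⁻¹ • NormedSpace.exp G.1, by
    have h := posDef_exp G.2
    have ht : 0 < (NormedSpace.exp G.1).trace := h.trace_pos
    refine ⟨h.posSemidef.smul (inv_nonneg.2 ht.le), ?_⟩
    rw [Matrix.trace_smul, smul_eq_mul, inv_mul_cancel₀ ht.ne']⟩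

/-- The logarithm `log ω` of a state, through the functional calculus of Hermitian matrices (with
the value `0` on the kernel of `ω`). -/
noncomputable def logState {n : ℕ} (ω : State n) : HermOp n :=
  ⟨cfc Real.log ω.1, cfc_predicate Real.log ω.1⟩

/-- The matrix exponentiated gradient update: `G = log ω - η ∇`, and the new state is
`exp G / Tr (exp G)`. -/
noncomputable def megUpdate {n : ℕ} (ω : State n) (g : HermOp n) (η : ℝ) : State n :=
  gibbs ⟨(logState ω).1 - η • g.1, (logState ω).2.sub (g.2.smul (IsSelfAdjoint.all _))⟩

/-- The objective `η ∑_s Tr (∇_s ω) + Tr (ω log ω)` of RFTL with von Neumann entropy; here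
`0 log 0 = 0`. -/
noncomputable def rftlObjective {n : ℕ} (gs : List (HermOp n)) (η : ℝ) (ω : State n) : ℝ :=
  η * (gs.map fun g => (g.1 * ω.1).trace.re).sum + (ω.1 * (logState ω).1).trace.re

/-- The RFTL update: the minimizer of the objective over all states. -/
noncomputable def rftlUpdate {n : ℕ} (gs : List (HermOp n)) (η : ℝ) : State n :=
  Classical.epsilon fun ω => ∀ σ : State n, rftlObjective gs η ω ≤ rftlObjective gs η σ

/-- The two options for the update inside a block. -/
inductive UpdateRule : Type
  | meg
  | rftl

/-- The learning rate `η_β = min {√(n ln 2 / (2^β + 1)), 1/2}` of block `β`. -/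
noncomputable def rate (n β : ℕ) : ℝ :=
  min (Real.sqrt (n * Real.log 2 / (2 ^ β + 1))) (1 / 2)

/-- The memory of the algorithm at the beginning of a round: the index `β` of the current block, the
gradients collected in this block, the loss `L_β` collected in this block, and the state that is
predicted in the coming round. -/
structure Memory (n : ℕ) where
  block : ℕ
  grads : List (HermOp n)
  blockLoss : ℝ
  pred : State n

/-- The memory at the beginning of block `β`: nothing is collected yet, the maximally mixed state is
predicted. -/
noncomputable def startBlock (n β : ℕ) : Memory n := ⟨β, [], 0, maxMixed n⟩

/-- One round of the doubling-trick algorithm, after which `r = (E_t, b_t)` is known. If the loss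
inside the block has reached `2^β`, a new block is started; otherwise the next prediction is
computed by the chosen update with learning rate `η_β`. -/
noncomputable def doublingStep {n : ℕ} (u : UpdateRule) (m : Memory n) (r : Round n) : Memory n :=
  open Classical in
  let g := gradient r m.pred
  let L := m.blockLoss + loss r m.pred
  if (2 : ℝ) ^ m.block ≤ L then startBlock n (m.block + 1)
  else
    { block := m.block
      grads := m.grads ++ [g]
      blockLoss := L
      pred := match u with
        | .meg => megUpdate m.pred g (rate n m.block)
        | .rftl => rftlUpdate (m.grads ++ [g]) (rate n m.block) }

/-- The doubling-trick algorithm as a learner; blocks are numbered from `1`. It needs neither `T`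
nor `L*_T`. -/
noncomputable def doublingTrick (n : ℕ) (u : UpdateRule) : Learner n := fun h =>
  (h.foldl (doublingStep u) (startBlock n 1)).pred

end QLearn

/-!
Upper bound. In the realizable case compactness gives a state `φ` with `Tr (E_t φ) = b_t` in all
rounds. Under both update rules the prediction inside a block is the Gibbs state of
`G = -η ∑_s ∇_s`: for the exponentiated gradient because `log (gibbs G)` is `G` up to a multiple of
the identity, for RFTL by the Gibbs variational principle. The potential
`log Tr exp G - Tr (G φ)` is nonnegative, starts at `n log 2`, and drops by at least `η` times the
loss in each round (`potential_step`). Instead of the Golden–Thompson inequality, this uses a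
Pinsker-type inequality for the relative entropy to a Gibbs state (`sq_yesProb_sub_le`): with the
eigenbases of both states, an elementary scalar inequality gives
`D(ω ‖ σ) ≥ 2 - 2 Tr (√ω √σ) = ‖√ω - √σ‖²`, and the Frobenius distance of the square roots dominates
the difference of the probabilities of any outcome.

So the loss in block `β` is at most `n log 2 / η_β`, and it can reach `2 ^ β` only if
`2 ^ β ≤ 2 n log 2` (`two_pow_le_of_rate_mul_le`). The losses of the blocks grow geometrically, which
bounds the total loss by `12 n`, independently of `T`.

Lower bound. The adversary measures the qubits one after the other and reveals the bit that is
farther from the prediction. Each of these `n` rounds costs at least `1 / 4`, while the computational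
basis state of the revealed bits has no loss.
-/

namespace QLearn

open Matrix
open scoped ComplexOrder

/-! ### Trace inequalities for Hermitian matrices -/

theorem continuousOn_spectrum_real {ι : Type*} [Fintype ι] [DecidableEq ι] (A : Matrix ι ι ℂ)
    (f : ℝ → ℝ) : ContinuousOn f (spectrum ℝ A) := by
  rw [continuousOn_iff_continuous_domRestrict]
  fun_prop

theorem exp_eq_cfc {ι : Type*} [Fintype ι] [DecidableEq ι] {A : Matrix ι ι ℂ}
    (hA : A.IsHermitian) : NormedSpace.exp A = cfc Real.exp A := by
  rw [hA.cfc_eq, IsHermitian.cfc, Unitary.conjStarAlgAut_apply]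
  conv_lhs => rw [hA.spectral_theorem, Unitary.conjStarAlgAut_apply]
  have hU : ((hA.eigenvectorUnitary : Matrix ι ι ℂ))⁻¹
      = star (hA.eigenvectorUnitary : Matrix ι ι ℂ) :=
    Matrix.inv_eq_right_inv (Unitary.coe_mul_star_self _)
  rw [← hU, Matrix.exp_conj _ _
    (IsUnit.of_mul_eq_one _ (Unitary.coe_mul_star_self hA.eigenvectorUnitary)),
    Matrix.exp_diagonal]
  congr 3
  ext i
  simp [Pi.coe_exp, ← Complex.exp_eq_exp_ℂ]

/-- The weights are the squared overlaps `|⟨uᵢ, vⱼ⟩|²` of the eigenvectors of `A` and `B`. -/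
theorem exists_trace_cfc_mul_cfc {ι : Type*} [Fintype ι] [DecidableEq ι] {A B : Matrix ι ι ℂ}
    (hA : A.IsHermitian) (hB : B.IsHermitian) :
    ∃ w : ι → ι → ℝ, (∀ i j, 0 ≤ w i j) ∧ ∀ f g : ℝ → ℝ,
      (cfc f A * cfc g B).trace.re
        = ∑ i, ∑ j, w i j * (f (hA.eigenvalues i) * g (hB.eigenvalues j)) := by
  set U : Matrix ι ι ℂ := hA.eigenvectorUnitary.1
  set V : Matrix ι ι ℂ := hB.eigenvectorUnitary.1
  refine ⟨fun i j => Complex.normSq ((star U * V) i j), fun i j => Complex.normSq_nonneg _, ?_⟩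
  intro f g
  rw [hA.cfc_eq, hB.cfc_eq, IsHermitian.cfc, IsHermitian.cfc, Unitary.conjStarAlgAut_apply,
    Unitary.conjStarAlgAut_apply]
  change ((U * _ * star U) * (V * _ * star V)).trace.re = _
  have h : ∀ D D' : Matrix ι ι ℂ, ((U * D * star U) * (V * D' * star V)).trace
      = (D * (star U * V) * (D' * star (star U * V))).trace := by
    intro D D'
    rw [star_mul, star_star, mul_assoc U, mul_assoc U, trace_mul_comm U]
    simp only [mul_assoc]
  rw [h, trace, Complex.re_sum]
  refine Finset.sum_congr rfl fun i _ => ?_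
  rw [diag_apply, mul_apply, Complex.re_sum]
  refine Finset.sum_congr rfl fun j _ => ?_
  rw [diagonal_mul, diagonal_mul, star_apply]
  simp only [Function.comp, RCLike.star_def, Complex.coe_algebraMap, Complex.normSq_apply]
  simp
  ring

/-- Klein's inequality: a pointwise inequality `0 ≤ ∑ fₖ(x) gₖ(y)` may be traced. -/
theorem trace_cfc_mul_cfc_sum_nonneg {ι κ : Type*} [Fintype ι] [DecidableEq ι] {A B : Matrix ι ι ℂ}
    (hA : A.IsHermitian) (hB : B.IsHermitian) (s : Finset κ) (f g : κ → ℝ → ℝ)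
    (h : ∀ x ∈ spectrum ℝ A, ∀ y, 0 ≤ ∑ k ∈ s, f k x * g k y) :
    0 ≤ ∑ k ∈ s, (cfc (f k) A * cfc (g k) B).trace.re := by
  obtain ⟨w, hw, hfg⟩ := exists_trace_cfc_mul_cfc hA hB
  simp only [hfg]
  rw [Finset.sum_comm]
  refine Finset.sum_nonneg fun i _ => ?_
  rw [Finset.sum_comm]
  refine Finset.sum_nonneg fun j _ => ?_
  rw [← Finset.mul_sum]
  exact mul_nonneg (hw i j) (h _ (hA.eigenvalues_mem_spectrum_real i) _)

/-- Cauchy–Schwarz for the trace inner product, with a free multiplier `t`. -/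
theorem two_mul_re_trace_le {ι : Type*} [Fintype ι] [DecidableEq ι] (X Y : Matrix ι ι ℂ) (t : ℝ) :
    2 * t * (Xᴴ * Y).trace.re ≤ (Xᴴ * X).trace.re + t ^ 2 * (Yᴴ * Y).trace.re := by
  have h1 := (Complex.le_def.1 (posSemidef_conjTranspose_mul_self (X - t • Y)).trace_nonneg).1
  have h2 : (Yᴴ * X).trace.re = (Xᴴ * Y).trace.re := by
    rw [← Complex.conj_re, ← Complex.star_def, ← trace_conjTranspose, conjTranspose_mul,
      conjTranspose_conjTranspose]
  rw [conjTranspose_sub, conjTranspose_smul, star_trivial,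
    sub_mul, mul_sub, mul_sub, trace_sub, trace_sub, trace_sub, smul_mul_assoc, smul_mul_assoc,
    mul_smul_comm, mul_smul_comm] at h1
  simp only [trace_smul, Complex.sub_re, Complex.smul_re, smul_eq_mul, h2, Complex.zero_re] at h1
  linarith

/-- The right side is `‖R - S‖²` in the Frobenius norm. Since `Tr R² = Tr S²`, the measurement `E`
may be replaced by `E - 1/2`, whose norm is at most `1/2`; then
`Tr ((E - 1/2) (R² - S²)) = Re Tr ((R - S) (E - 1/2) (R + S))`, and `‖R + S‖ ≤ 2`. -/
theorem sq_trace_mul_sub_le {ι : Type*} [Fintype ι] [DecidableEq ι] {E R S : Matrix ι ι ℂ}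
    (hE : E.PosSemidef) (hE' : (1 - E).PosSemidef) (hR : R.IsHermitian) (hS : S.IsHermitian)
    (hR1 : (R * R).trace = 1) (hS1 : (S * S).trace = 1) :
    ((E * (R * R)).trace.re - (E * (S * S)).trace.re) ^ 2 ≤ 2 - 2 * (R * S).trace.re := by
  have hEh := hE.isHermitian.eq
  have hD : (R - S)ᴴ = R - S := (hR.sub hS).eq
  have hP : (R + S)ᴴ = R + S := (hR.add hS).eq
  have hM : (2 • E - 1)ᴴ = 2 • E - 1 := by
    rw [conjTranspose_sub, conjTranspose_one, conjTranspose_nsmul, hEh]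
  have hSR : (S * R).trace = (R * S).trace := trace_mul_comm _ _
  -- `(2 E - 1)² ≤ 1`, compressed by `R - S`
  have hM2 : 0 ≤ ((R - S) * (R - S)).trace.re
      - ((R - S) * (2 • E - 1) * ((2 • E - 1) * (R - S))).trace.re := by
    have h1 := ((hE'.conjTranspose_mul_mul_same (E * (R - S))).add
      (hE.conjTranspose_mul_mul_same ((1 - E) * (R - S)))).trace_nonneg
    have h2 := (Complex.le_def.1 h1).1
    rw [conjTranspose_mul, conjTranspose_mul, hE'.isHermitian.eq, hEh, hD] at h2
    have h3 : (R - S) * (R - S) - (R - S) * (2 • E - 1) * ((2 • E - 1) * (R - S))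
        = 4 • ((R - S) * E * (1 - E) * (E * (R - S))
          + (R - S) * (1 - E) * E * ((1 - E) * (R - S))) := by
      noncomm_ring
    rw [← Complex.sub_re, ← trace_sub, h3, trace_smul, Complex.re_nsmul]
    simp only [Complex.zero_re] at h2
    exact nsmul_nonneg h2 4
  have hDD : ((R - S) * (R - S)).trace.re = 2 - 2 * (R * S).trace.re := by
    simp only [mul_sub, sub_mul, trace_sub, hR1, hS1, hSR]
    simp; ring
  have hPP : ((R + S) * (R + S)).trace.re = 2 + 2 * (R * S).trace.re := by
    simp only [mul_add, add_mul, trace_add, hR1, hS1, hSR]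
    simp; ring
  have hDP : ((R - S) * (2 • E - 1) * (R + S)).trace.re
      = 2 * ((E * (R * R)).trace.re - (E * (S * S)).trace.re) := by
    -- the cross terms cancel because `Tr (E S R)` is the conjugate of `Tr (E R S)`
    have h1 : (E * (S * R)).trace.re = (E * (R * S)).trace.re := by
      have h2 : (E * (S * R)).trace = star (E * (R * S)).trace := by
        rw [← trace_conjTranspose, conjTranspose_mul, conjTranspose_mul, hR.eq, hS.eq, hEh,
          trace_mul_comm]
      rw [h2, Complex.star_def, Complex.conj_re]
    have h3 : ((R - S) * (2 • E - 1) * (R + S)).trace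
        = 2 * (E * (R * R)).trace - 2 * (E * (S * S)).trace
          + 2 * ((E * (S * R)).trace - (E * (R * S)).trace) := by
      rw [mul_assoc, trace_mul_comm]
      have h4 : (2 • E - 1) * (R + S) * (R - S) = 2 • (E * (R * R)) - 2 • (E * (S * S))
          + 2 • (E * (S * R) - E * (R * S)) - R * R + S * S - S * R + R * S := by
        noncomm_ring
      rw [h4]
      simp only [trace_add, trace_sub, trace_smul, hR1, hS1, hSR]
      simp only [nsmul_eq_mul]
      push_cast; ring
    rw [h3]
    simp [h1]
    ring
  set d := (E * (R * R)).trace.re - (E * (S * S)).trace.re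
  have hN : 0 ≤ ((R - S) * (2 • E - 1) * ((2 • E - 1) * (R - S))).trace.re := by
    have h1 := (Complex.le_def.1
      (posSemidef_conjTranspose_mul_self ((2 • E - 1) * (R - S))).trace_nonneg).1
    rwa [conjTranspose_mul, hM, hD] at h1
  -- `d / 2` is the optimal multiplier when `‖R + S‖ = 2`
  have hCS := two_mul_re_trace_le ((2 • E - 1) * (R - S)) (R + S) (d / 2)
  rw [conjTranspose_mul, hM, hD, hP, hDP, hPP] at hCS
  rw [hDD] at hM2
  nlinarith [mul_nonneg (sq_nonneg d) (show 0 ≤ 1 - (R * S).trace.re by linarith)]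

variable {n : ℕ}

/-! ### Relative entropy to a Gibbs state -/

/-- The log-partition function `log Tr exp G`. -/
noncomputable def logPartition (G : HermOp n) : ℝ := Real.log (NormedSpace.exp G.1).trace.re

theorem trace_exp_re_pos (G : HermOp n) : 0 < (NormedSpace.exp G.1).trace.re :=
  (Complex.lt_def.1 (posDef_exp G.2).trace_pos).1

theorem trace_exp_eq_ofReal (G : HermOp n) :
    (NormedSpace.exp G.1).trace = ((NormedSpace.exp G.1).trace.re : ℂ) :=
  Complex.ext rfl (Complex.lt_def.1 (posDef_exp G.2).trace_pos).2.symm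

theorem gibbs_eq_cfc (G : HermOp n) :
    (gibbs G).1 = cfc (fun y => Real.exp y / (NormedSpace.exp G.1).trace.re) G.1 := by
  change (NormedSpace.exp G.1).trace⁻¹ • NormedSpace.exp G.1 = _
  set Z := (NormedSpace.exp G.1).trace.re
  rw [trace_exp_eq_ofReal G, ← Complex.ofReal_inv]
  have h : (fun y => Real.exp y / Z) = fun y => Z⁻¹ • Real.exp y := by
    ext y; rw [smul_eq_mul, div_eq_inv_mul]
  rw [h, cfc_smul _ _ _ (continuousOn_spectrum_real _ _), exp_eq_cfc G.2]
  ext i j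
  simp [Z, exp_eq_cfc G.2]

theorem cfc_const_sub_id {A : Op n} (hA : A.IsHermitian) (c : ℝ) :
    cfc (fun y => c - y) A = c • (1 : Op n) - A := by
  have hA' : IsSelfAdjoint A := hA
  rw [cfc_sub _ _ A (continuousOn_spectrum_real _ _) (continuousOn_spectrum_real _ _),
    cfc_const c A, cfc_id' ℝ A, Algebra.algebraMap_eq_smul_one]

theorem logState_gibbs (G : HermOp n) :
    (logState (gibbs G)).1 = G.1 - logPartition G • (1 : Op n) := by
  change cfc Real.log (gibbs G).1 = _
  have hG : IsSelfAdjoint G.1 := G.2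
  rw [gibbs_eq_cfc, ← cfc_comp' _ _ _ ?_ (continuousOn_spectrum_real _ _)]
  · have h : (fun y => Real.log (Real.exp y / (NormedSpace.exp G.1).trace.re))
        = fun y => y - logPartition G := by
      ext y
      rw [Real.log_div (Real.exp_ne_zero _) (trace_exp_re_pos G).ne', Real.log_exp, logPartition]
    rw [h, cfc_sub _ _ _ (continuousOn_spectrum_real _ _) (continuousOn_spectrum_real _ _),
      cfc_const _ G.1, cfc_id' ℝ G.1, Algebra.algebraMap_eq_smul_one]
  · rintro _ ⟨y, _, rfl⟩
    exact (Real.continuousAt_log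
      (div_pos (Real.exp_pos _) (trace_exp_re_pos G)).ne').continuousWithinAt

theorem State.nonneg_of_mem_spectrum (ω : State n) {x : ℝ} (hx : x ∈ spectrum ℝ ω.1) : 0 ≤ x := by
  rw [ω.2.1.isHermitian.spectrum_real_eq_range_eigenvalues] at hx
  obtain ⟨i, rfl⟩ := hx
  exact ω.2.1.eigenvalues_nonneg i

theorem State.sqrt_mul_sqrt (ω : State n) : cfc Real.sqrt ω.1 * cfc Real.sqrt ω.1 = ω.1 := by
  have h : IsSelfAdjoint ω.1 := ω.2.1.isHermitian
  rw [← cfc_mul _ _ _ (continuousOn_spectrum_real _ _) (continuousOn_spectrum_real _ _)]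
  conv_rhs => rw [← cfc_id' ℝ ω.1]
  exact cfc_congr fun x hx => Real.mul_self_sqrt (ω.nonneg_of_mem_spectrum hx)

/-- The negative von Neumann entropy `Tr (ω log ω)`, with `0 log 0 = 0`. -/
noncomputable def negEntropy (ω : State n) : ℝ := (ω.1 * (logState ω).1).trace.re

theorem mul_log_eq_cfc (ω : State n) :
    ω.1 * (logState ω).1 = cfc (fun x => x * Real.log x) ω.1 := by
  have h : IsSelfAdjoint ω.1 := ω.2.1.isHermitian
  rw [cfc_mul _ _ _ (continuousOn_spectrum_real _ _) (continuousOn_spectrum_real _ _),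
    cfc_id' ℝ ω.1]
  rfl

theorem State.le_one_of_mem_spectrum (ω : State n) {x : ℝ} (hx : x ∈ spectrum ℝ ω.1) : x ≤ 1 := by
  have hω := ω.2.1.isHermitian
  rw [hω.spectrum_real_eq_range_eigenvalues] at hx
  obtain ⟨i, rfl⟩ := hx
  have h1 := hω.trace_eq_sum_eigenvalues
  rw [ω.2.2] at h1
  have h2 := congrArg Complex.re h1
  simp only [Complex.one_re, Complex.re_sum, Complex.coe_algebraMap, Complex.ofReal_re] at h2
  rw [h2]
  exact Finset.single_le_sum (fun j _ => ω.2.1.eigenvalues_nonneg j) (Finset.mem_univ i)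

theorem negEntropy_nonpos (ω : State n) : negEntropy ω ≤ 0 := by
  have hω : IsSelfAdjoint ω.1 := ω.2.1.isHermitian
  have h := trace_cfc_mul_cfc_sum_nonneg ω.2.1.isHermitian ω.2.1.isHermitian
    (Finset.univ : Finset (Fin 1)) (fun _ x => -(x * Real.log x)) (fun _ _ => 1) (by
      intro x hx y
      simpa using mul_nonpos_of_nonneg_of_nonpos (ω.nonneg_of_mem_spectrum hx)
        (Real.log_nonpos (ω.nonneg_of_mem_spectrum hx) (ω.le_one_of_mem_spectrum hx)))
  simp only [Finset.univ_unique, Finset.sum_singleton] at h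
  rw [cfc_const 1 ω.1, map_one, mul_one, cfc_neg, ← mul_log_eq_cfc, trace_neg, Complex.neg_re] at h
  exact neg_nonneg.1 h

/-- With `q = exp y / Z` this says `x log (x / q) ≥ 2 x - 2 √x √q`, which is `log s ≤ s - 1` at
`s = √q / √x`. -/
theorem relEntropy_scalar {x y Z : ℝ} (hx : 0 ≤ x) (hZ : 0 < Z) :
    0 ≤ x * Real.log x + x * (Real.log Z - 2 - y)
      + Real.sqrt x * (2 * Real.sqrt (Real.exp y / Z)) := by
  rcases hx.eq_or_lt with rfl | hx
  · simp
  have hq : 0 < Real.exp y / Z := div_pos (Real.exp_pos _) hZ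
  have hlq : Real.log (Real.exp y / Z) = y - Real.log Z := by
    rw [Real.log_div (Real.exp_ne_zero _) hZ.ne', Real.log_exp]
  set q := Real.exp y / Z
  have h1 := Real.log_le_sub_one_of_pos (div_pos (Real.sqrt_pos.2 hq) (Real.sqrt_pos.2 hx))
  rw [Real.log_div (Real.sqrt_pos.2 hq).ne' (Real.sqrt_pos.2 hx).ne', Real.log_sqrt hq.le,
    Real.log_sqrt hx.le, hlq] at h1
  have h2 : x * (Real.sqrt q / Real.sqrt x) = Real.sqrt x * Real.sqrt q := by
    have h3 := Real.mul_self_sqrt hx.le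
    field_simp
    nlinarith
  nlinarith [mul_le_mul_of_nonneg_left h1 hx.le]

/-- A Pinsker-type inequality: the right side is the relative entropy `D(ω ‖ gibbs G)`. The scalar
inequality, summed over both eigenbases, bounds it below by `2 - 2 Tr (√ω √(gibbs G))`, and this
dominates the squared difference of the outcome probabilities. -/
theorem sq_yesProb_sub_le (E : Measurement n) (ω : State n) (G : HermOp n) :
    (yesProb E ω - yesProb E (gibbs G)) ^ 2
      ≤ negEntropy ω - (G.1 * ω.1).trace.re + logPartition G := by
  have hω : IsSelfAdjoint ω.1 := ω.2.1.isHermitian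
  have hG : IsSelfAdjoint G.1 := G.2
  set Z := (NormedSpace.exp G.1).trace.re with hZdef
  have hZ : 0 < Z := trace_exp_re_pos G
  set R := cfc Real.sqrt ω.1
  set S := cfc (fun y => Real.sqrt (Real.exp y / Z)) G.1
  have hRR : R * R = ω.1 := ω.sqrt_mul_sqrt
  have hSS : S * S = (gibbs G).1 := by
    rw [gibbs_eq_cfc,
      ← cfc_mul _ _ _ (continuousOn_spectrum_real _ _) (continuousOn_spectrum_real _ _)]
    exact cfc_congr fun y _ => Real.mul_self_sqrt (div_pos (Real.exp_pos _) hZ).le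
  have h1 := sq_trace_mul_sub_le E.2.1 E.2.2 (cfc_predicate Real.sqrt ω.1 : IsSelfAdjoint _)
    (cfc_predicate (fun y => Real.sqrt (Real.exp y / Z)) G.1 : IsSelfAdjoint _)
    (by rw [ω.sqrt_mul_sqrt]; exact ω.2.2) (by rw [hSS]; exact (gibbs G).2.2)
  have h2 := trace_cfc_mul_cfc_sum_nonneg ω.2.1.isHermitian G.2 (Finset.univ : Finset (Fin 3))
    ![fun x => x * Real.log x, fun x => x, Real.sqrt]
    ![fun _ => 1, fun y => Real.log Z - 2 - y, fun y => (2 : ℝ) • Real.sqrt (Real.exp y / Z)]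
    (by
      intro x hx y
      rw [Fin.sum_univ_three]
      simpa using relEntropy_scalar (y := y) (ω.nonneg_of_mem_spectrum hx) hZ)
  rw [Fin.sum_univ_three] at h2
  simp only [Matrix.cons_val_zero, Matrix.cons_val_one, Matrix.cons_val] at h2
  rw [cfc_const 1 G.1, cfc_const_sub_id G.2, cfc_id' ℝ ω.1, ← mul_log_eq_cfc,
    cfc_smul _ _ _ (continuousOn_spectrum_real _ _), map_one, mul_one, mul_sub, trace_sub,
    mul_smul_comm, mul_smul_comm, mul_one, trace_smul, trace_smul, ω.2.2, trace_mul_comm ω.1 G.1,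
    Complex.sub_re, Complex.smul_re, Complex.smul_re, Complex.one_re] at h2
  rw [hRR, hSS] at h1
  simp only [smul_eq_mul] at h2
  unfold negEntropy logPartition yesProb
  linarith

theorem negEntropy_gibbs (G : HermOp n) :
    negEntropy (gibbs G) = (G.1 * (gibbs G).1).trace.re - logPartition G := by
  rw [negEntropy, logState_gibbs, mul_sub, trace_sub, mul_smul_comm, mul_one, trace_smul,
    (gibbs G).2.2, trace_mul_comm, Complex.sub_re, Complex.smul_re, Complex.one_re, smul_eq_mul,
    mul_one]

/-! ### The Gibbs variational principle -/

theorem yesProb_nonneg (E : Measurement n) (ω : State n) : 0 ≤ yesProb E ω := by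
  have hR : (cfc Real.sqrt ω.1).IsHermitian := (cfc_predicate Real.sqrt ω.1 : IsSelfAdjoint _)
  have h := (Complex.le_def.1 (E.2.1.conjTranspose_mul_mul_same (cfc Real.sqrt ω.1)).trace_nonneg).1
  rwa [hR.eq, trace_mul_comm, ← mul_assoc, ω.sqrt_mul_sqrt, trace_mul_comm] at h

theorem yesProb_le_one (E : Measurement n) (ω : State n) : yesProb E ω ≤ 1 := by
  have h := yesProb_nonneg ⟨1 - E.1, E.2.2, by rw [sub_sub_cancel]; exact E.2.1⟩ ω
  change 0 ≤ ((1 - E.1) * ω.1).trace.re at h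
  rw [sub_mul, trace_sub, one_mul, ω.2.2, Complex.sub_re, Complex.one_re] at h
  exact sub_nonneg.1 h

theorem State.one_sub_posSemidef (ω : State n) : (1 - ω.1).PosSemidef := by
  have h : IsSelfAdjoint ω.1 := ω.2.1.isHermitian
  have hT : (cfc (fun x => Real.sqrt (1 - x)) ω.1).IsHermitian :=
    (cfc_predicate (fun x => Real.sqrt (1 - x)) ω.1 : IsSelfAdjoint _)
  have h1 := posSemidef_conjTranspose_mul_self (cfc (fun x => Real.sqrt (1 - x)) ω.1)
  rw [hT.eq, ← cfc_mul _ _ _ (continuousOn_spectrum_real _ _) (continuousOn_spectrum_real _ _),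
    cfc_congr fun x hx => Real.mul_self_sqrt (sub_nonneg.2 (ω.le_one_of_mem_spectrum hx)),
    cfc_const_sub_id ω.2.1.isHermitian, one_smul] at h1
  exact h1

/-- States are themselves measurements, so equal outcome probabilities for `ω` and `σ` force
`Tr (ω - σ)² = 0`. -/
theorem State.ext_yesProb {ω σ : State n} (h : ∀ E : Measurement n, yesProb E ω = yesProb E σ) :
    ω = σ := by
  have h1 := h ⟨ω.1, ω.2.1, ω.one_sub_posSemidef⟩
  have h2 := h ⟨σ.1, σ.2.1, σ.one_sub_posSemidef⟩
  simp only [yesProb] at h1 h2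
  have hH : (ω.1 - σ.1)ᴴ = ω.1 - σ.1 := (ω.2.1.isHermitian.sub σ.2.1.isHermitian).eq
  have h3 : ((ω.1 - σ.1)ᴴ * (ω.1 - σ.1)).trace = 0 := by
    refine Complex.ext ?_
      (Complex.le_def.1 (posSemidef_conjTranspose_mul_self (ω.1 - σ.1)).trace_nonneg).2.symm
    rw [hH, sub_mul, mul_sub, mul_sub, trace_sub, trace_sub, trace_sub, Complex.sub_re,
      Complex.sub_re, Complex.sub_re, h1, h2, sub_self, sub_self, sub_self, Complex.zero_re]
  exact Subtype.ext (sub_eq_zero.1 (trace_conjTranspose_mul_self_eq_zero_iff.1 h3))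

/-- Uniqueness in the Gibbs variational principle. -/
theorem eq_gibbs_of_forall_le (G : HermOp n) {ω : State n}
    (h : ∀ σ : State n, negEntropy ω - (G.1 * ω.1).trace.re
      ≤ negEntropy σ - (G.1 * σ.1).trace.re) : ω = gibbs G := by
  refine State.ext_yesProb fun E => ?_
  have h1 := sq_yesProb_sub_le E ω G
  have h2 := h (gibbs G)
  rw [negEntropy_gibbs] at h2
  have h3 : (yesProb E ω - yesProb E (gibbs G)) ^ 2 ≤ 0 := by linarith
  exact sub_eq_zero.1 (pow_eq_zero_iff two_ne_zero |>.1 (le_antisymm h3 (sq_nonneg _)))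

theorem negEntropy_gibbs_sub_le (G : HermOp n) (σ : State n) :
    negEntropy (gibbs G) - (G.1 * (gibbs G).1).trace.re
      ≤ negEntropy σ - (G.1 * σ.1).trace.re := by
  have h := (sq_nonneg _).trans
    (sq_yesProb_sub_le ⟨1, PosSemidef.one, by rw [sub_self]; exact PosSemidef.zero⟩ σ G)
  rw [negEntropy_gibbs]
  linarith

theorem gibbs_sub_smul_one (G H : HermOp n) (c : ℝ) (h : H.1 = G.1 - c • (1 : Op n)) :
    gibbs H = gibbs G := by
  refine eq_gibbs_of_forall_le G fun σ => ?_
  have h1 := negEntropy_gibbs_sub_le H σ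
  have h2 : ∀ ω : State n, (H.1 * ω.1).trace.re = (G.1 * ω.1).trace.re - c := by
    intro ω
    rw [h, sub_mul, smul_mul_assoc, one_mul, trace_sub, trace_smul, ω.2.2, Complex.sub_re,
      Complex.smul_re, Complex.one_re, smul_eq_mul, mul_one]
  rw [h2, h2] at h1
  linarith

/-! ### The updates as Gibbs states -/

/-- The exponent `-η ∑_s ∇_s` of the Gibbs state predicted after the gradients `gs`. -/
noncomputable def cumGrad (gs : List (HermOp n)) (η : ℝ) : HermOp n :=
  ⟨-η • (gs.map fun g : HermOp n => g.1).sum, by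
    refine IsHermitian.smul ?_ (IsSelfAdjoint.all _)
    induction gs with
    | nil => exact isHermitian_zero
    | cons g gs ih => rw [List.map_cons, List.sum_cons]; exact g.2.add ih⟩

theorem cumGrad_append (gs : List (HermOp n)) (g : HermOp n) (η : ℝ) :
    (cumGrad (gs ++ [g]) η).1 = (cumGrad gs η).1 - η • g.1 := by
  simp [cumGrad, sub_eq_add_neg]

theorem megUpdate_gibbs (gs : List (HermOp n)) (g : HermOp n) (η : ℝ) :
    megUpdate (gibbs (cumGrad gs η)) g η = gibbs (cumGrad (gs ++ [g]) η) := by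
  refine gibbs_sub_smul_one _ _ (logPartition (cumGrad gs η)) ?_
  change (logState (gibbs (cumGrad gs η))).1 - η • g.1 = _
  rw [logState_gibbs, cumGrad_append]
  abel

theorem rftlObjective_eq (gs : List (HermOp n)) (η : ℝ) (ω : State n) :
    rftlObjective gs η ω = negEntropy ω - ((cumGrad gs η).1 * ω.1).trace.re := by
  have h : (gs.map fun g => (g.1 * ω.1).trace.re).sum
      = ((gs.map fun g : HermOp n => g.1).sum * ω.1).trace.re := by
    induction gs with
    | nil => simp
    | cons g gs ih =>
      rw [List.map_cons, List.sum_cons, List.map_cons, List.sum_cons, add_mul, trace_add,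
        Complex.add_re, ih]
  change η * (gs.map fun g => (g.1 * ω.1).trace.re).sum + negEntropy ω = _
  rw [h, cumGrad, smul_mul_assoc, trace_smul, Complex.smul_re, smul_eq_mul]
  ring

theorem rftlUpdate_eq_gibbs (gs : List (HermOp n)) (η : ℝ) :
    rftlUpdate gs η = gibbs (cumGrad gs η) := by
  have h : ∃ ω, ∀ σ : State n, rftlObjective gs η ω ≤ rftlObjective gs η σ :=
    ⟨gibbs (cumGrad gs η), fun σ => by
      rw [rftlObjective_eq, rftlObjective_eq]
      exact negEntropy_gibbs_sub_le _ σ⟩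
  refine eq_gibbs_of_forall_le _ fun σ => ?_
  rw [← rftlObjective_eq, ← rftlObjective_eq]
  exact Classical.epsilon_spec h σ

theorem exp_cumGrad_nil (η : ℝ) : NormedSpace.exp (cumGrad ([] : List (HermOp n)) η).1 = 1 := by
  change NormedSpace.exp (-η • (0 : Op n)) = 1
  rw [smul_zero, NormedSpace.exp_zero]

theorem gibbs_cumGrad_nil (η : ℝ) : gibbs (cumGrad ([] : List (HermOp n)) η) = maxMixed n := by
  apply Subtype.ext
  rw [gibbs, maxMixed]
  simp only [exp_cumGrad_nil]
  simp [trace_one]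

theorem logPartition_cumGrad_nil (η : ℝ) :
    logPartition (cumGrad ([] : List (HermOp n)) η) = n * Real.log 2 := by
  rw [logPartition, exp_cumGrad_nil, trace_one]
  have h : ((2 : ℂ) ^ n).re = (2 : ℝ) ^ n := by exact_mod_cast Complex.ofReal_re ((2 : ℝ) ^ n)
  simp [h, Real.log_pow]

/-! ### The potential -/

/-- The potential `log Tr exp G - Tr (G φ)` of the Gibbs state of `G` relative to `φ`. It is the
relative entropy `D(φ ‖ gibbs G)` without the term `Tr (φ log φ)`, which does not depend on `G`. -/
noncomputable def potential (φ : State n) (G : HermOp n) : ℝ :=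
  logPartition G - (G.1 * φ.1).trace.re

theorem potential_nonneg (φ : State n) (G : HermOp n) : 0 ≤ potential φ G := by
  have h := negEntropy_gibbs_sub_le G φ
  rw [negEntropy_gibbs] at h
  have := negEntropy_nonpos φ
  unfold potential
  linarith

/-- One update lowers the potential by at least `η` times the loss. With `x`, `x'` the learner's
probabilities before and after the update and `b = Tr (E φ)`, it drops by at least
`2 η (x - b)² + 2 η (x - b) (x' - x) + (x' - x)² ≥ (2 η - η²) (x - b)²`. -/
theorem potential_step (φ : State n) (r : Round n) (gs : List (HermOp n)) {η : ℝ} (h0 : 0 ≤ η)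
    (h1 : η ≤ 1) (hφ : yesProb r.1 φ = r.2) :
    potential φ (cumGrad (gs ++ [gradient r (gibbs (cumGrad gs η))]) η)
        + η * loss r (gibbs (cumGrad gs η))
      ≤ potential φ (cumGrad gs η) := by
  set G := cumGrad gs η
  set G' := cumGrad (gs ++ [gradient r (gibbs G)]) η
  have h2 : ∀ ω : State n, (G'.1 * ω.1).trace.re
      = (G.1 * ω.1).trace.re - η * (2 * (yesProb r.1 (gibbs G) - r.2) * yesProb r.1 ω) := by
    intro ω
    rw [cumGrad_append, sub_mul, trace_sub, smul_mul_assoc, trace_smul, gradient, smul_mul_assoc,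
      trace_smul, Complex.sub_re, Complex.smul_re, Complex.smul_re, smul_eq_mul, smul_eq_mul]
    rfl
  have h3 := sq_yesProb_sub_le r.1 (gibbs G') G
  rw [negEntropy_gibbs, h2] at h3
  unfold potential loss
  rw [h2 φ, hφ]
  set x := yesProb r.1 (gibbs G)
  set x' := yesProb r.1 (gibbs G')
  -- complete the square in `x' - x`
  nlinarith [sq_nonneg (x' - x + η * (x - r.2)),
    mul_nonneg (mul_nonneg h0 (sub_nonneg.2 h1)) (sq_nonneg (x - r.2))]

/-! ### The doubling-trick algorithm -/

theorem potential_cumGrad_nil (φ : State n) (η : ℝ) :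
    potential φ (cumGrad [] η) = n * Real.log 2 := by
  have h : ((cumGrad ([] : List (HermOp n)) η).1 * φ.1).trace.re = 0 := by
    change (((-η • (0 : Op n)) * φ.1).trace).re = 0
    rw [smul_zero, zero_mul, trace_zero, Complex.zero_re]
  rw [potential, logPartition_cumGrad_nil, h, sub_zero]

theorem loss_nonneg (r : Round n) (ω : State n) : 0 ≤ loss r ω := sq_nonneg _

theorem loss_le_one {r : Round n} {φ : State n} (h : yesProb r.1 φ = r.2) (ω : State n) :
    loss r ω ≤ 1 := by
  rw [loss, ← h, sq_le_one_iff_abs_le_one, abs_le]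
  have h1 := yesProb_nonneg r.1 ω
  have h2 := yesProb_le_one r.1 ω
  have h3 := yesProb_nonneg r.1 φ
  have h4 := yesProb_le_one r.1 φ
  constructor <;> linarith

theorem rate_nonneg (n β : ℕ) : 0 ≤ rate n β := le_min (Real.sqrt_nonneg _) (by norm_num)

theorem rate_le_one (n β : ℕ) : rate n β ≤ 1 := (min_le_right _ _).trans (by norm_num)

/-- Both values that the learning rate can take make `n log 2 / η_β < 2 ^ β` as soon as
`2 ^ β` exceeds `2 n log 2`. -/
theorem two_pow_le_of_rate_mul_le {β : ℕ} (hn : 1 ≤ n)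
    (h : rate n β * 2 ^ β ≤ n * Real.log 2) : (2 : ℝ) ^ β ≤ 2 * (n * Real.log 2) := by
  by_contra! hlt
  have hN : 0 < n * Real.log 2 :=
    mul_pos (by exact_mod_cast hn) (Real.log_pos one_lt_two)
  have hp : (1 : ℝ) ≤ 2 ^ β := one_le_pow₀ one_le_two
  have hp0 : (0 : ℝ) < 2 ^ β := by positivity
  rw [rate] at h
  set N := n * Real.log 2
  set p : ℝ := 2 ^ β
  have h1 : N / p < min (Real.sqrt (N / (p + 1))) (1 / 2) := by
    refine lt_min ?_ ?_
    · rw [Real.lt_sqrt (by positivity), div_pow, div_lt_div_iff₀ (by positivity) (by positivity)]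
      nlinarith [mul_pos hN hp0]
    · rw [div_lt_div_iff₀ hp0 two_pos]
      linarith
  rw [← le_div_iff₀ hp0] at h
  exact absurd h1 (not_lt.2 h)

/-- What holds at the beginning of every round, relative to a state `φ` without loss, when `total`
is the loss suffered so far. The potential of the current block plus `η_β` times the loss in this
block is at most its initial value `n log 2`. Each finished block `k` has cost at most
`2 ^ k + 1 ≤ 2 * 2 ^ k`, which sums to `2 * 2 ^ β - 4`; and a block beyond the first is reached only
while `2 ^ (β - 1) ≤ 2 n log 2`. -/
structure DoublingInvariant (φ : State n) (total : ℝ) (m : Memory n) : Prop where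
  pred_eq : m.pred = gibbs (cumGrad m.grads (rate n m.block))
  potential_add_le : potential φ (cumGrad m.grads (rate n m.block)) + rate n m.block * m.blockLoss
    ≤ n * Real.log 2
  blockLoss_lt : m.blockLoss < 2 ^ m.block
  total_le : total + 4 ≤ 2 * 2 ^ m.block + m.blockLoss
  block_le : m.block = 1 ∨ (2 : ℝ) ^ m.block ≤ 4 * (n * Real.log 2)

theorem doublingInvariant_startBlock (φ : State n) {total : ℝ} {β : ℕ}
    (h : total + 4 ≤ 2 * 2 ^ β) (hβ : β = 1 ∨ (2 : ℝ) ^ β ≤ 4 * (n * Real.log 2)) :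
    DoublingInvariant φ total (startBlock n β) where
  pred_eq := (gibbs_cumGrad_nil _).symm
  potential_add_le := by simp [startBlock, potential_cumGrad_nil]
  blockLoss_lt := by simp [startBlock]
  total_le := by simpa [startBlock] using h
  block_le := hβ

theorem DoublingInvariant.step {φ : State n} {total : ℝ} {m : Memory n} (hn : 1 ≤ n)
    (h : DoublingInvariant φ total m) (u : UpdateRule) {r : Round n} (hr : yesProb r.1 φ = r.2) :
    DoublingInvariant φ (total + loss r m.pred) (doublingStep u m r) := by
  obtain ⟨hp, hpot, hlt, htot, hblk⟩ := h
  have hstep := potential_step φ r m.grads (rate_nonneg n m.block) (rate_le_one n m.block) hr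
  rw [← hp] at hstep
  have hle : rate n m.block * (m.blockLoss + loss r m.pred)
      + potential φ (cumGrad (m.grads ++ [gradient r m.pred]) (rate n m.block))
      ≤ n * Real.log 2 := by linarith
  have hl1 := loss_le_one hr m.pred
  unfold doublingStep
  by_cases hc : (2 : ℝ) ^ m.block ≤ m.blockLoss + loss r m.pred
  · -- the block ends: the potential, also after this round, is nonnegative
    simp only [if_pos hc]
    have h1 : (2 : ℝ) ^ m.block ≤ 2 * (n * Real.log 2) := by
      refine two_pow_le_of_rate_mul_le hn ?_
      have h2 := mul_le_mul_of_nonneg_left hc (rate_nonneg n m.block)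
      have h3 := potential_nonneg φ
        (cumGrad (m.grads ++ [gradient r m.pred]) (rate n m.block))
      linarith
    have hp1 : (1 : ℝ) ≤ 2 ^ m.block := one_le_pow₀ one_le_two
    refine doublingInvariant_startBlock φ ?_ (Or.inr ?_)
    · rw [pow_succ]; linarith
    · rw [pow_succ]; linarith
  · simp only [if_neg hc]
    refine ⟨?_, ?_, not_le.1 hc, ?_, hblk⟩
    · cases u with
      | meg =>
        change megUpdate m.pred _ _ = _
        conv_lhs => rw [hp]
        rw [megUpdate_gibbs, ← hp]
      | rftl => exact rftlUpdate_eq_gibbs _ _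
    · change potential φ (cumGrad (m.grads ++ [gradient r m.pred]) (rate n m.block))
        + rate n m.block * (m.blockLoss + loss r m.pred) ≤ _
      linarith
    · change total + loss r m.pred + 4 ≤ 2 * 2 ^ m.block + (m.blockLoss + loss r m.pred)
      linarith

theorem doublingInvariant_learnerLoss (hn : 1 ≤ n) (u : UpdateRule) (φ : State n)
    (r : ℕ → Round n) (T : ℕ) (hr : ∀ t < T, yesProb (r t).1 φ = (r t).2) :
    DoublingInvariant φ (learnerLoss (doublingTrick n u) r T)
      (((List.range T).map r).foldl (doublingStep u) (startBlock n 1)) := by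
  induction T with
  | zero => exact doublingInvariant_startBlock φ (by norm_num [learnerLoss]) (Or.inl rfl)
  | succ T ih =>
    have h := (ih fun t ht => hr t (ht.trans T.lt_succ_self)).step hn u (hr T T.lt_succ_self)
    rw [learnerLoss, Finset.sum_range_succ, List.range_succ, List.map_append, List.foldl_append]
    exact h

/-- The first block, which is not bounded by the potential, costs less than `2 ≤ 2 n`; this is
where `1 ≤ n` enters. -/
theorem learnerLoss_doublingTrick_le_of_pos (hn : 1 ≤ n) (u : UpdateRule) (φ : State n)
    (r : ℕ → Round n) (T : ℕ) (hr : ∀ t < T, yesProb (r t).1 φ = (r t).2) :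
    learnerLoss (doublingTrick n u) r T ≤ 12 * n := by
  obtain ⟨-, -, hlt, htot, hblk⟩ := doublingInvariant_learnerLoss hn u φ r T hr
  set m := ((List.range T).map r).foldl (doublingStep u) (startBlock n 1)
  have hn' : (1 : ℝ) ≤ n := by exact_mod_cast hn
  have h2 : (2 : ℝ) ^ m.block ≤ 4 * n := by
    rcases hblk with h | h
    · rw [h]; linarith
    · nlinarith [Real.log_two_lt_d9]
  linarith

/-! ### Compactness and the realizable case -/

/-- The states are the image of the sphere `Tr (Bᴴ B) = 1` under `B ↦ Bᴴ B`. -/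
theorem isCompact_states (n : ℕ) : IsCompact {A : Op n | A.PosSemidef ∧ A.trace = 1} := by
  have hcont : Continuous fun B : Op n => Bᴴ * B := by fun_prop
  have hK : IsCompact {B : Op n | (Bᴴ * B).trace = 1} := by
    have hbox : IsCompact (Set.univ.pi fun _ : Fin n → Fin 2 =>
        Set.univ.pi fun _ : Fin n → Fin 2 => Metric.closedBall (0 : ℂ) 1) :=
      isCompact_univ_pi fun _ => isCompact_univ_pi fun _ => isCompact_closedBall _ _
    refine hbox.of_isClosed_subset (isClosed_eq hcont.matrix_trace continuous_const) ?_
    intro (B : Op n) hB i _ j _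
    have h1 : ∑ j, ∑ i, Complex.normSq (B i j) = 1 := by
      have h2 := congrArg Complex.re (show (Bᴴ * B).trace = 1 from hB)
      simpa [trace, mul_apply, Complex.normSq_apply] using h2
    have h2 : Complex.normSq (B i j) ≤ 1 := by
      rw [← h1]
      exact (Finset.single_le_sum (f := fun i => Complex.normSq (B i j))
        (fun _ _ => Complex.normSq_nonneg _) (Finset.mem_univ i)).trans
        (Finset.single_le_sum (f := fun j => ∑ i, Complex.normSq (B i j))
          (fun _ _ => Finset.sum_nonneg fun _ _ => Complex.normSq_nonneg _) (Finset.mem_univ j))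
    rw [mem_closedBall_zero_iff, ← sq_le_one_iff₀ (norm_nonneg _), ← Complex.normSq_eq_norm_sq]
    exact h2
  convert hK.image hcont
  ext A
  constructor
  · intro hA
    have hR : (cfc Real.sqrt A).IsHermitian := (cfc_predicate Real.sqrt A : IsSelfAdjoint _)
    have hRR := State.sqrt_mul_sqrt ⟨A, hA⟩
    refine ⟨cfc Real.sqrt A, ?_, ?_⟩
    · change ((cfc Real.sqrt A)ᴴ * _).trace = 1
      rw [hR.eq, hRR]
      exact hA.2
    · change (cfc Real.sqrt A)ᴴ * _ = A
      rw [hR.eq, hRR]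
  · rintro ⟨B, hB, rfl⟩
    exact ⟨posSemidef_conjTranspose_mul_self B, hB⟩

/-- The infimum `L*_T` is attained, so in the realizable case some state suffers no loss. -/
theorem exists_yesProb_eq_of_bestLoss_eq_zero {r : ℕ → Round n} {T : ℕ} (h : bestLoss r T = 0) :
    ∃ φ : State n, ∀ t < T, yesProb (r t).1 φ = (r t).2 := by
  have hcont : Continuous fun A : Op n =>
      ∑ t ∈ Finset.range T, (((r t).1.1 * A).trace.re - (r t).2) ^ 2 := by
    refine continuous_finsetSum _ fun t _ => ?_
    exact ((Complex.continuous_re.comp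
      (continuous_const.matrix_mul continuous_id).matrix_trace).sub continuous_const).pow 2
  obtain ⟨A, hA, hmin⟩ := (isCompact_states n).exists_isMinOn
    ⟨(maxMixed n).1, (maxMixed n).2⟩ hcont.continuousOn
  have h1 : ∑ t ∈ Finset.range T, loss (r t) ⟨A, hA⟩ ≤ 0 := by
    rw [← h]
    exact le_ciInf fun ω => hmin ω.2
  refine ⟨⟨A, hA⟩, fun t ht => ?_⟩
  have h2 := (Finset.sum_eq_zero_iff_of_nonneg fun t _ => loss_nonneg (r t) ⟨A, hA⟩).1
    (le_antisymm h1 (Finset.sum_nonneg fun t _ => loss_nonneg _ _)) t (Finset.mem_range.2 ht)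
  exact sub_eq_zero.1 (pow_eq_zero_iff two_ne_zero |>.1 h2)

/-- Without qubits there is only one state. -/
theorem subsingleton_state_zero : Subsingleton (State 0) := by
  refine ⟨fun ω σ => Subtype.ext ?_⟩
  have h : ∀ ρ : State 0, ρ.1 default default = 1 := fun ρ =>
    (Fintype.sum_subsingleton (fun i => ρ.1 i i) default).symm.trans ρ.2.2
  ext i j
  rw [Subsingleton.elim i default, Subsingleton.elim j default, h, h]

theorem learnerLoss_doublingTrick_le (n : ℕ) (u : UpdateRule) (φ : State n)
    (r : ℕ → Round n) (T : ℕ) (hr : ∀ t < T, yesProb (r t).1 φ = (r t).2) :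
    learnerLoss (doublingTrick n u) r T ≤ 12 * n := by
  rcases Nat.eq_zero_or_pos n with rfl | hn
  · have := subsingleton_state_zero
    refine le_of_eq_of_le (Finset.sum_eq_zero fun t ht => ?_) (by simp)
    rw [Subsingleton.elim (prediction _ r t) φ, loss, hr t (Finset.mem_range.1 ht), sub_self,
      zero_pow two_ne_zero]
  · exact learnerLoss_doublingTrick_le_of_pos hn u φ r T hr

/-! ### The adversary for the lower bound -/

theorem bestLoss_eq_zero {r : ℕ → Round n} {T : ℕ} {φ : State n}
    (h : ∀ t, yesProb (r t).1 φ = (r t).2) : bestLoss r T = 0 := by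
  refine le_antisymm ?_ (Real.iInf_nonneg fun ω => Finset.sum_nonneg fun t _ => loss_nonneg _ _)
  refine (ciInf_le ⟨0, ?_⟩ φ).trans_eq (Finset.sum_eq_zero fun t _ => ?_)
  · rintro _ ⟨ω, rfl⟩
    exact Finset.sum_nonneg fun t _ => loss_nonneg _ _
  · rw [loss, h, sub_self, zero_pow two_ne_zero]

/-- Measurement of the `i`th qubit in the computational basis. -/
noncomputable def qubitMeasurement (i : Fin n) : Measurement n :=
  ⟨diagonal fun x => if x i = 1 then 1 else 0, by
    refine ⟨posSemidef_diagonal_iff.2 fun x => ?_, ?_⟩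
    · split_ifs <;> simp
    · rw [← diagonal_one, diagonal_sub, posSemidef_diagonal_iff]
      intro x
      split_ifs <;> simp⟩

/-- The computational basis state `|x⟩⟨x|` of the bit string `x`. -/
noncomputable def basisState (x : Fin n → Fin 2) : State n :=
  ⟨diagonal (Pi.single x 1), by
    refine ⟨posSemidef_diagonal_iff.2 fun y => ?_, by simp [trace_diagonal]⟩
    rw [Pi.single_apply]
    split_ifs <;> simp⟩

theorem yesProb_qubitMeasurement_basisState (i : Fin n) (x : Fin n → Fin 2) :
    yesProb (qubitMeasurement i) (basisState x) = if x i = 1 then 1 else 0 := by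
  rw [yesProb, qubitMeasurement, basisState, diagonal_mul_diagonal, trace_diagonal]
  simp [Pi.single_apply]
  split_ifs <;> simp

/-- The adversary's move after the history `h` against the learner `A`: in the first `n` rounds it
measures a fresh qubit and reveals the bit that is farther from the learner's prediction; afterwards
it plays the trivial measurement, on which every state has loss zero. -/
noncomputable def adversaryRound (A : Learner n) (h : List (Round n)) : Round n :=
  open Classical in
  if hn : h.length < n then
    (qubitMeasurement ⟨h.length, hn⟩,
      if yesProb (qubitMeasurement ⟨h.length, hn⟩) (A h) ≤ 1 / 2 then 1 else 0)
  else (⟨0, PosSemidef.zero, by rw [sub_zero]; exact PosSemidef.one⟩, 0)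

/-- The first `t` rounds between the learner `A` and the adversary. -/
noncomputable def adversaryHistory (A : Learner n) : ℕ → List (Round n)
  | 0 => []
  | t + 1 => adversaryHistory A t ++ [adversaryRound A (adversaryHistory A t)]

theorem map_range_adversaryRound (A : Learner n) (t : ℕ) :
    (List.range t).map (fun s => adversaryRound A (adversaryHistory A s))
      = adversaryHistory A t := by
  induction t with
  | zero => rfl
  | succ t ih => rw [List.range_succ, List.map_append, ih]; rfl

theorem length_adversaryHistory (A : Learner n) (t : ℕ) : (adversaryHistory A t).length = t := by
  rw [← map_range_adversaryRound, List.length_map, List.length_range]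

theorem one_fourth_le_loss_adversaryRound (A : Learner n) {h : List (Round n)}
    (hn : h.length < n) : 1 / 4 ≤ loss (adversaryRound A h) (A h) := by
  rw [adversaryRound, dif_pos hn, loss]
  split_ifs with hc
  · nlinarith
  · nlinarith

/-- All bits revealed by the adversary are those of one computational basis state. -/
theorem exists_yesProb_adversaryRound_eq (A : Learner n) :
    ∃ φ : State n, ∀ t, yesProb (adversaryRound A (adversaryHistory A t)).1 φ
      = (adversaryRound A (adversaryHistory A t)).2 := by
  classical
  refine ⟨basisState fun i => if (adversaryRound A (adversaryHistory A i)).2 = 1 then 1 else 0,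
    fun t => ?_⟩
  have hlen := length_adversaryHistory A t
  generalize hh : adversaryHistory A t = h at *
  subst hlen
  by_cases hn : h.length < n
  · have h1 : (adversaryRound A h).1 = qubitMeasurement ⟨h.length, hn⟩ := by
      rw [adversaryRound, dif_pos hn]
    have h2 : (adversaryRound A h).2 = 1 ∨ (adversaryRound A h).2 = 0 := by
      rw [adversaryRound, dif_pos hn]
      dsimp only
      split_ifs <;> simp
    rw [h1, yesProb_qubitMeasurement_basisState]
    simp only [hh]
    rcases h2 with h2 | h2 <;> simp [h2]
  · rw [adversaryRound, dif_neg hn]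
    simp [yesProb]

end QLearn

theorem corollary2 :
    (∃ C : ℝ, 0 < C ∧ ∀ (n T : ℕ) (u : QLearn.UpdateRule) (r : ℕ → QLearn.Round n),
      2 ≤ T → QLearn.bestLoss r T = 0 →
        QLearn.regret (QLearn.doublingTrick n u) r T ≤ C * n * Real.log T) ∧
    (∃ c : ℝ, 0 < c ∧ ∀ (n T : ℕ), n ≤ T → ∀ A : QLearn.Learner n,
      ∃ r : ℕ → QLearn.Round n, QLearn.bestLoss r T = 0 ∧ c * n ≤ QLearn.regret A r T) := by
  constructor
  · refine ⟨24, by norm_num, fun n T u r hT h0 => ?_⟩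
    obtain ⟨φ, hφ⟩ := QLearn.exists_yesProb_eq_of_bestLoss_eq_zero h0
    have h1 := QLearn.learnerLoss_doublingTrick_le n u φ r T hφ
    have h2 : 1 / 2 ≤ Real.log T :=
      le_trans (by linarith [Real.log_two_gt_d9])
        (Real.log_le_log two_pos (by exact_mod_cast hT : (2 : ℝ) ≤ T))
    rw [QLearn.regret, h0, sub_zero]
    nlinarith [mul_le_mul_of_nonneg_left h2 (Nat.cast_nonneg n : (0 : ℝ) ≤ n)]
  · refine ⟨1 / 4, by norm_num, fun n T hT A => ?_⟩
    obtain ⟨φ, hφ⟩ := QLearn.exists_yesProb_adversaryRound_eq A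
    have h0 := QLearn.bestLoss_eq_zero (T := T) hφ
    refine ⟨_, h0, ?_⟩
    rw [QLearn.regret, h0, sub_zero, QLearn.learnerLoss]
    refine le_trans ?_ (Finset.sum_le_sum_of_subset_of_nonneg (Finset.range_subset_range.2 hT)
      fun t _ _ => QLearn.loss_nonneg _ _)
    refine le_of_eq_of_le ?_ (Finset.card_nsmul_le_sum _ _ (1 / 4) fun t ht => ?_)
    · rw [Finset.card_range, nsmul_eq_mul, mul_comm]
    · rw [QLearn.prediction, QLearn.map_range_adversaryRound]
      exact QLearn.one_fourth_le_loss_adversaryRound A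
        (by rw [QLearn.length_adversaryHistory]; exact Finset.mem_range.1 ht)
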